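/- **Setting.** Let $\mathfrak{X}$ be a real Banach space, $C\subset\mathfrak{X}$ a convex set, $\Theta$ a nonempty set, and let $\mathcal{P}$ index a family of probability distributions. Let $\mathcal{T}=\{t\in\mathfrak{X}^*:\|t\|_{\mathfrak{X}^*}\le 1\}$, with the weak-* topology $\mathcal{U}$. For $c\in C$ let $T_cC=\{\alpha(c'-c): c'\in C,\ \alpha>0\}$ be the tangent cone, and let $N_cC=\{t\in\mathfrak{X}^*:\langle x,t\rangle\le 1 \text{ for all } x\in T_cC\}$, the polar of $T_cC$, be the normal cone. For a metric space $E$ (distances may be infinite), let $\mathrm{BL}_1(E)$ be the set of $1$-Lipschitz functions $h:E\to\mathbb{R}$ with $|h|\le 1$. For maps $Z_{n,P}$ from probability spaces to $E$ and Borel measurable random elements $Z_P$ of $E$, write $Z_{n,P}\rightsquigarrow Z_P$ uniformly in $P\in\mathcal{P}$ if $$\lim_{n\to\infty}\ \sup_{P\in\mathcal{P}}\ \sup_{h\in\mathrm{BL}_1(E)}\bigl|\mathrm{E}_P^*[h(Z_{n,P})]-\mathrm{E}[h(Z_P)]\bigr|=0,$$ where $\mathrm{E}_P^*$ is the outer expectation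 (the usual expectation for measurable arguments). **Assumptions.** Let $m_P(\theta)\in C$ for all $P\in\mathcal{P}$, $\theta\in\Theta$, let $m_{n,P}(\theta)$ be random elements of $\mathfrak{X}$, and let $r_n\to\infty$ be real numbers. 1. $\mathbb{G}_{n,P}=\bigl(\theta\mapsto r_n(m_{n,P}(\theta)-m_P(\theta))\bigr)\rightsquigarrow\mathbb{G}_P$ uniformly in $P\in\mathcal{P}$, where $E$ is the set of maps $\Theta\to\mathfrak{X}$ with the uniform distance $\sup_{\theta\in\Theta}\|G(\theta)-G'(\theta)\|_{\mathfrak{X}}$. 2. The collection $\{\mathbb{G}_P(\theta)\}$ is uniformly pre-tight in $\mathfrak{X}$: for every $\varepsilon>0$ there is a totally bounded and Borel measurable $S\subset\mathfrak{X}$ with $\inf_{P\in\mathcal{P}}\Pr(\mathbb{G}_P(\theta)\in S\ \text{for all}\ \theta\in\Theta)>1-\varepsilon$. 3. There is a topology $\mathcal{W}$ on $\mathcal{P}\times\Theta$ (not necessarily a product topology) such that $(\mathcal{P}\times\Theta,\mathcal{W})$ is compact, the correspondence $(P,\theta)\mapsto\mathcal{T}\cap N_{m_P(\theta)}C$ into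 $(\mathcal{T},\mathcal{U})$ is $\mathcal{W}$-lower hemicontinuous, and $(P,\theta,t)\mapsto\langle m_P(\theta),t\rangle$ is $\mathcal{W}\times\mathcal{U}$-upper semicontinuous on $\mathcal{P}\times\Theta\times\mathcal{T}$. **Conclusion.** Uniformly in $P\in\mathcal{P}$, as real-valued random elements, $$r_n\inf_{\theta\in\Theta}d_{\mathfrak{X}}(m_{n,P}(\theta),C)\ \rightsquigarrow\ \inf_{\theta\in\Theta}\ \sup_{\substack{t\in N_{m_P(\theta)}C\\ \|t\|_{\mathfrak{X}^*}\le 1}}\langle\mathbb{G}_P(\theta),t\rangle=\inf_{\theta\in\Theta}d_{\mathfrak{X}}\bigl(\mathbb{G}_P(\theta),T_{m_P(\theta)}C\bigr),$$ where $d_{\mathfrak{X}}(x,A)=\inf_{a\in A}\|x-a\|_{\mathfrak{X}}$ and the equality holds for every realization of $\mathbb{G}_P$. -/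

import Mathlib

open Filter Topology MeasureTheory
open scoped ENNReal NNReal UniformConvergence

/-- The outer expectation `E^* f` of a bounded, not necessarily measurable, function `f`: the
infimum of `E u` over the measurable integrable `u ≥ f`. It is the usual expectation if `f` is
measurable. -/
noncomputable def outerExpectation {Ω : Type*} [MeasurableSpace Ω] (μ : Measure Ω)
    (f : Ω → ℝ) : ℝ :=
  sInf {a : ℝ | ∃ u : Ω → ℝ, Measurable u ∧ Integrable u μ ∧ (∀ ω, f ω ≤ u ω) ∧ ∫ ω, u ω ∂μ = a}

/-- `BL_1(E)`: the `1`-Lipschitz functions `E → ℝ` that are bounded by `1` in magnitude. -/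
def boundedLipschitz (E : Type*) [PseudoEMetricSpace E] : Set (E → ℝ) :=
  {h | LipschitzWith 1 h ∧ ∀ x, |h x| ≤ 1}

/-- `Z_{n,P} ⇝ Z_P` uniformly in `P`, in the bounded Lipschitz metric: the limits `Z_P` are Borel
measurable random elements of `E`, and
`sup_P sup_{h ∈ BL_1(E)} |E_P^* h(Z_{n,P}) - E h(Z_P)| → 0` as `n → ∞`. The elements `Z_{n,P}` are
arbitrary maps on probability spaces, which is why outer expectations appear. -/
def UniformWeakConvergence {𝔓 E : Type*} [PseudoEMetricSpace E]
    {Ω : ℕ → 𝔓 → Type*} [∀ n P, MeasurableSpace (Ω n P)] (μ : ∀ n P, Measure (Ω n P))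
    (Zn : ∀ n P, Ω n P → E)
    {Ω' : 𝔓 → Type*} [∀ P, MeasurableSpace (Ω' P)] (ν : ∀ P, Measure (Ω' P))
    (Z : ∀ P, Ω' P → E) : Prop :=
  (∀ P, Measurable[_, borel E] (Z P)) ∧
  Tendsto
    (fun n => ⨆ P : 𝔓, ⨆ h ∈ boundedLipschitz E,
      ENNReal.ofReal |outerExpectation (μ n P) (fun ω => h (Zn n P ω)) - ∫ ω, h (Z P ω) ∂(ν P)|)
    atTop (𝓝 0)

/-- The family of random maps `G_P : Θ → X` is uniformly pre-tight in `X`: for every `ε > 0` there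
is a totally bounded Borel set `S` with `inf_P Pr(G_P(θ) ∈ S for all θ) > 1 - ε`. -/
def UniformlyPretight {𝔓 Θ X : Type*} [NormedAddCommGroup X]
    {Ω' : 𝔓 → Type*} [∀ P, MeasurableSpace (Ω' P)] (ν : ∀ P, Measure (Ω' P))
    (G : ∀ P, Ω' P → Θ → X) : Prop :=
  ∀ ε : ℝ, 0 < ε → ∃ S : Set X, TotallyBounded S ∧ MeasurableSet[borel X] S ∧
    1 - ENNReal.ofReal ε < ⨅ P : 𝔓, ν P {ω | ∀ θ, G P ω θ ∈ S}

section Cones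

variable {X : Type*} [NormedAddCommGroup X] [NormedSpace ℝ X]

/-- The tangent cone `T_c C`: all points `α (c' - c)` with `c' ∈ C` and `α > 0`. -/
def convexTangentCone (C : Set X) (c : X) : Set X :=
  {x | ∃ α : ℝ, 0 < α ∧ ∃ c' ∈ C, x = α • (c' - c)}

/-- The (one-sided) polar of a set, as a subset of the dual with its weak-* topology. -/
def oneSidedPolar (K : Set X) : Set (WeakDual ℝ X) :=
  {t | ∀ x ∈ K, t x ≤ 1}

/-- The normal cone `N_c C`, the polar of the tangent cone. -/
def convexNormalCone (C : Set X) (c : X) : Set (WeakDual ℝ X) :=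
  oneSidedPolar (convexTangentCone C c)

variable (X) in
/-- The closed unit ball of the dual (for the dual norm), with the weak-* topology. -/
def dualUnitBall : Set (WeakDual ℝ X) :=
  {t | ‖WeakDual.toStrongDual t‖ ≤ 1}

end Cones

/-! ### Duality for distances to convex sets, tangent cones and dilations. -/

section ConvexDistance

variable {X : Type*} [NormedAddCommGroup X] [NormedSpace ℝ X]

/-! Scaling turns the statistic into a functional of the process: `r_n d(m_n, C)` is the distance of
`r_n (m_n - m)` to `r_n (C - m)` (`mul_infDist_eq_infDist_dilationAt`). The infimum over `θ` of such
distances is 1-Lipschitz for the uniform distance, so composing with it preserves `BL_1`, and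
uniform weak convergence allows the process to be replaced by its limit although the functional
depends on `n` and `P`.

It remains to replace `r_n (C - m)` by the tangent cone. These sets increase to the cone, so
distances to them decrease pointwise. The convergence is uniform on the compact space of pairs by a
Dini argument (`eventually_infDist_dilationAt_lt`): Hahn-Banach duality makes the distance to a
dilation upper semicontinuous and the distance to the cone lower semicontinuous. Pre-tightness
confines the limit to a totally bounded set, where a finite net suffices. -/

theorem apply_le_norm_of_mem_dualUnitBall {t : WeakDual ℝ X} (ht : t ∈ dualUnitBall X) (x : X) :
    t x ≤ ‖x‖ := by
  have h := (WeakDual.toStrongDual t).le_of_opNorm_le ht x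
  rw [one_mul] at h
  exact (le_abs_self _).trans h

theorem zero_mem_dualUnitBall : (0 : WeakDual ℝ X) ∈ dualUnitBall X := by
  simp [dualUnitBall]

theorem isCompact_dualUnitBall : IsCompact (dualUnitBall X) := by
  have h := WeakDual.isCompact_closedBall (𝕜 := ℝ) (E := X) 0 1
  convert h using 1
  ext t
  simp [dualUnitBall]

/-- A functional in the dual unit ball that separates `x` from `K` by the margin `a` bounds the
distance of `x` to `K` from below. -/
theorem le_infDist_of_separating {K : Set X} (hne : K.Nonempty) {x : X} {a : ℝ}
    {t : WeakDual ℝ X} (ht : t ∈ dualUnitBall X) (h : ∀ y ∈ K, a + t y ≤ t x) :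
    a ≤ Metric.infDist x K := by
  refine (Metric.le_infDist hne).2 fun y hy => ?_
  have h1 := apply_le_norm_of_mem_dualUnitBall ht (x - y)
  rw [map_sub] at h1
  rw [dist_eq_norm]
  linarith [h y hy]

/-- The distance to a convex set is attained in the dual problem. -/
theorem exists_separating_infDist {K : Set X} (hK : Convex ℝ K) (x : X) :
    ∃ t ∈ dualUnitBall X, ∀ y ∈ K, Metric.infDist x K + t y ≤ t x := by
  rcases (Metric.infDist_nonneg (x := x) (s := K)).eq_or_lt with h0 | hpos
  · exact ⟨0, zero_mem_dualUnitBall, fun y _ => by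
      change Metric.infDist x K + (0 : ℝ) ≤ 0
      simp [← h0]⟩
  set d := Metric.infDist x K
  obtain ⟨f, u, hf, hu⟩ := geometric_hahn_banach_open (convex_ball x d) Metric.isOpen_ball hK
    Metric.disjoint_ball_infDist
  have hfx : f x < u := hf x (Metric.mem_ball_self hpos)
  have hbound : ∀ v : X, ‖v‖ < d → f v < u - f x := fun v hv => by
    have := hf (x + v) (by simpa [Metric.mem_ball, dist_eq_norm] using hv)
    rw [map_add] at this
    linarith
  -- Rescaling `v` to norm `b < d` and letting `b` tend to `d` bounds the norm of `f` by `(u - f x)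
  -- / d`.
  have hle : ∀ v : X, d * f v ≤ (u - f x) * ‖v‖ := fun v => by
    rcases eq_or_ne v 0 with rfl | hv
    · simp
    have hvpos : 0 < ‖v‖ := norm_pos_iff.2 hv
    have key : ∀ b, 0 < b → b < d → b * f v ≤ (u - f x) * ‖v‖ := fun b hb hbd => by
      have h1 := hbound ((b / ‖v‖) • v) (by
        rw [norm_smul, Real.norm_of_nonneg (by positivity), div_mul_cancel₀ _ hvpos.ne']
        exact hbd)
      rw [map_smul, smul_eq_mul, div_mul_eq_mul_div, div_lt_iff₀ hvpos] at h1
      exact h1.le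
    refine le_of_tendsto (((continuous_id.mul continuous_const).tendsto d).mono_left
      (nhdsWithin_le_nhds (s := Set.Iio d))) ?_
    filter_upwards [Ioo_mem_nhdsLT hpos] with b hb using key b hb.1 hb.2
  have hκ : 0 < u - f x := sub_pos.2 hfx
  -- The sign flips because `f` is smaller on the ball than on `K`; the factor brings the norm to at
  -- most 1.
  set g : StrongDual ℝ X := (-(d / (u - f x))) • f with hg
  have hgv : ∀ v, g v = -(d * f v / (u - f x)) := fun v => by
    simp [hg]; ring
  refine ⟨StrongDual.toWeakDual g, ?_, fun y hy => ?_⟩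
  · change ‖g‖ ≤ 1
    refine ContinuousLinearMap.opNorm_le_bound _ zero_le_one fun v => ?_
    rw [hgv, norm_neg, one_mul, Real.norm_eq_abs, abs_le]
    have h1 := hle v
    have h2 := hle (-v)
    rw [map_neg, norm_neg] at h2
    constructor
    · rw [le_div_iff₀ hκ]; linarith
    · rw [div_le_iff₀ hκ]; linarith
  · change d + g y ≤ g x
    rw [hgv, hgv]
    have h1 : d * (u - f x) ≤ d * (f y - f x) :=
      mul_le_mul_of_nonneg_left (by linarith [hu y hy]) hpos.le
    have h2 : d ≤ d * (f y - f x) / (u - f x) := (le_div_iff₀ hκ).2 h1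
    have h3 : d * (f y - f x) / (u - f x) = d * f y / (u - f x) - d * f x / (u - f x) := by ring
    linarith

theorem zero_mem_convexTangentCone {C : Set X} {c : X} (hc : c ∈ C) :
    (0 : X) ∈ convexTangentCone C c :=
  ⟨1, one_pos, c, hc, by simp⟩

theorem smul_mem_convexTangentCone {C : Set X} {c y : X} (hy : y ∈ convexTangentCone C c) {β : ℝ}
    (hβ : 0 < β) : β • y ∈ convexTangentCone C c := by
  obtain ⟨α, hα, c', hc', rfl⟩ := hy
  exact ⟨β * α, mul_pos hβ hα, c', hc', smul_smul _ _ _⟩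

theorem convex_convexTangentCone {C : Set X} (hC : Convex ℝ C) (c : X) :
    Convex ℝ (convexTangentCone C c) := by
  rintro _ ⟨α, hα, y, hy, rfl⟩ _ ⟨β, hβ, z, hz, rfl⟩ a b ha hb hab
  have hpos : 0 < a * α + b * β := by
    rcases ha.eq_or_lt with rfl | ha'
    · obtain rfl : b = 1 := by linarith
      simpa using hβ
    · exact add_pos_of_pos_of_nonneg (mul_pos ha' hα) (mul_nonneg hb hβ.le)
  refine ⟨a * α + b * β, hpos, (a * α / (a * α + b * β)) • y + (b * β / (a * α + b * β)) • z,
    hC hy hz (by positivity) (by positivity) (by field_simp), ?_⟩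
  have hcancel : ∀ k : ℝ, (a * α + b * β) * (k / (a * α + b * β)) = k := fun k => by field_simp
  calc a • α • (y - c) + b • β • (z - c)
      = (a * α) • y + (b * β) • z - (a * α + b * β) • c := by module
    _ = _ := by rw [smul_sub, smul_add, smul_smul, smul_smul, hcancel, hcancel]

/-- A linear functional that is bounded above on the tangent cone is nonpositive there. -/
theorem apply_nonpos_of_bounded_on_convexTangentCone {C : Set X} {c : X} {t : WeakDual ℝ X} {b : ℝ}
    (h : ∀ y ∈ convexTangentCone C c, t y ≤ b) {y : X} (hy : y ∈ convexTangentCone C c) :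
    t y ≤ 0 := by
  by_contra! hpos
  -- Scaling `y` by this factor gives `t` the value `|b| + 1`, above the bound `b`.
  have hβ : 0 < (|b| + 1) / t y := by positivity
  have := h _ (smul_mem_convexTangentCone hy hβ)
  rw [map_smul, smul_eq_mul, div_mul_cancel₀ _ hpos.ne'] at this
  linarith [le_abs_self b]

theorem apply_le_infDist_convexTangentCone {C : Set X} {c : X} (hc : c ∈ C) {t : WeakDual ℝ X}
    (ht : t ∈ dualUnitBall X ∩ convexNormalCone C c) (x : X) :
    t x ≤ Metric.infDist x (convexTangentCone C c) :=
  le_infDist_of_separating ⟨0, zero_mem_convexTangentCone hc⟩ ht.1 fun y hy => by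
    linarith [apply_nonpos_of_bounded_on_convexTangentCone ht.2 hy]

theorem exists_apply_eq_infDist_convexTangentCone {C : Set X} (hC : Convex ℝ C) {c : X}
    (hc : c ∈ C) (x : X) :
    ∃ t ∈ dualUnitBall X ∩ convexNormalCone C c,
      t x = Metric.infDist x (convexTangentCone C c) := by
  obtain ⟨t, ht, h⟩ := exists_separating_infDist (convex_convexTangentCone hC c) x
  have hN : t ∈ convexNormalCone C c := fun y hy =>
    (apply_nonpos_of_bounded_on_convexTangentCone (b := t x)
      (fun z hz => (le_add_of_nonneg_left Metric.infDist_nonneg).trans (h z hz)) hy).trans zero_le_one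
  refine ⟨t, ⟨ht, hN⟩, le_antisymm (apply_le_infDist_convexTangentCone hc ⟨ht, hN⟩ x) ?_⟩
  simpa using h 0 (zero_mem_convexTangentCone hc)

/-- The distance to the tangent cone is the support function of the bounded normal cone. -/
theorem iSup_normalCone_eq_infDist {C : Set X} (hC : Convex ℝ C) {c : X} (hc : c ∈ C) (x : X) :
    (⨆ t : ↥(dualUnitBall X ∩ convexNormalCone C c), (t : WeakDual ℝ X) x) =
      Metric.infDist x (convexTangentCone C c) := by
  obtain ⟨t, ht, htx⟩ := exists_apply_eq_infDist_convexTangentCone hC hc x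
  have : Nonempty ↥(dualUnitBall X ∩ convexNormalCone C c) := ⟨⟨t, ht⟩⟩
  refine le_antisymm (ciSup_le fun s => apply_le_infDist_convexTangentCone hc s.2 x) ?_
  rw [← htx]
  exact le_ciSup (f := fun t : ↥(dualUnitBall X ∩ convexNormalCone C c) => (t : WeakDual ℝ X) x)
    ⟨_, Set.forall_mem_range.2 fun s => apply_le_infDist_convexTangentCone hc s.2 x⟩ ⟨t, ht⟩

/-- The set `s (C - c)`. -/
def dilationAt (C : Set X) (c : X) (s : ℝ) : Set X :=
  (fun y => s • (y - c)) '' C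

theorem dilationAt_nonempty {C : Set X} {c : X} (hc : c ∈ C) (s : ℝ) :
    (dilationAt C c s).Nonempty :=
  ⟨_, Set.mem_image_of_mem _ hc⟩

theorem convex_dilationAt {C : Set X} (hC : Convex ℝ C) (c : X) (s : ℝ) :
    Convex ℝ (dilationAt C c s) := by
  rintro _ ⟨y, hy, rfl⟩ _ ⟨z, hz, rfl⟩ a b ha hb hab
  refine ⟨a • y + b • z, hC hy hz ha hb hab, ?_⟩
  obtain rfl : b = 1 - a := by linarith
  module

theorem dilationAt_subset_convexTangentCone (C : Set X) (c : X) {s : ℝ} (hs : 0 < s) :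
    dilationAt C c s ⊆ convexTangentCone C c := by
  rintro _ ⟨y, hy, rfl⟩
  exact ⟨s, hs, y, hy, rfl⟩

/-- Since `c ∈ C`, contracting a point of `C` towards `c` by `s / s'` stays in `C`. -/
theorem dilationAt_mono {C : Set X} (hC : Convex ℝ C) {c : X} (hc : c ∈ C) {s s' : ℝ} (hs : 0 < s)
    (hss' : s ≤ s') : dilationAt C c s ⊆ dilationAt C c s' := by
  have hs' : 0 < s' := hs.trans_le hss'
  rintro _ ⟨y, hy, rfl⟩
  refine ⟨(s / s') • y + (1 - s / s') • c, hC hy hc (by positivity)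
    (sub_nonneg.2 ((div_le_one hs').2 hss')) (by ring), ?_⟩
  have h : s' * (s / s') = s := by field_simp
  calc s' • ((s / s') • y + (1 - s / s') • c - c) = (s' * (s / s')) • (y - c) := by module
    _ = s • (y - c) := by rw [h]

theorem mul_infDist_eq_infDist_dilationAt {C : Set X} {c : X} (hc : c ∈ C) {s : ℝ} (hs : 0 ≤ s)
    (x : X) : s * Metric.infDist x C = Metric.infDist (s • (x - c)) (dilationAt C c s) := by
  have hdist : ∀ y, dist (s • (x - c)) (s • (y - c)) = s * dist x y := fun y => by
    rw [dist_smul₀, dist_sub_right, Real.norm_of_nonneg hs]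
  refine le_antisymm ((Metric.le_infDist (dilationAt_nonempty hc s)).2 ?_) ?_
  · rintro _ ⟨y, hy, rfl⟩
    rw [hdist]
    exact mul_le_mul_of_nonneg_left (Metric.infDist_le_dist_of_mem hy) hs
  · rcases hs.eq_or_lt with rfl | hs
    · simpa using (Metric.infDist_le_dist_of_mem (x := (0 : ℝ) • (x - c))
        (show _ ∈ dilationAt C c 0 from ⟨c, hc, rfl⟩))
    rw [← div_le_iff₀' hs]
    refine (Metric.le_infDist ⟨c, hc⟩).2 fun y hy => ?_
    rw [div_le_iff₀' hs, ← hdist]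
    exact Metric.infDist_le_dist_of_mem ⟨y, hy, rfl⟩

theorem infDist_convexTangentCone_le_infDist_dilationAt {C : Set X} {c : X} (hc : c ∈ C) {s : ℝ}
    (hs : 0 < s) (x : X) :
    Metric.infDist x (convexTangentCone C c) ≤ Metric.infDist x (dilationAt C c s) :=
  Metric.infDist_le_infDist_of_subset (dilationAt_subset_convexTangentCone C c hs)
    (dilationAt_nonempty hc s)

end ConvexDistance

/-! ### Semicontinuity of the distances and the Dini argument. -/

section Semicontinuity

variable {X : Type*} [NormedAddCommGroup X] [NormedSpace ℝ X] {Y : Type*} [TopologicalSpace Y]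
  {C : Set X} {m : Y → X}

/-- By duality, a superlevel set consists of the `p` for which some `t` in the dual ball separates
with margin `b`. It is the projection of a closed set along the weak-* compact ball, hence closed.
-/
theorem upperSemicontinuous_infDist_dilationAt (hC : Convex ℝ C) (hm : ∀ p, m p ∈ C)
    (husc : UpperSemicontinuous
      (fun q : Y × dualUnitBall X => (q.2 : WeakDual ℝ X) (m q.1)))
    {s : ℝ} (hs : 0 < s) (x : X) :
    UpperSemicontinuous fun p => Metric.infDist x (dilationAt C (m p) s) := by
  refine upperSemicontinuous_iff_isClosed_preimage.2 fun b => ?_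
  have : CompactSpace (dualUnitBall X) := isCompact_iff_compactSpace.1 isCompact_dualUnitBall
  have heval : ∀ y : X, Continuous fun q : Y × dualUnitBall X => (q.2 : WeakDual ℝ X) y :=
    fun y => (WeakDual.eval_continuous y).comp (continuous_subtype_val.comp continuous_snd)
  have hclosed : IsClosed {q : Y × dualUnitBall X |
      ∀ c ∈ C, b + s * (q.2 : WeakDual ℝ X) c ≤
        (q.2 : WeakDual ℝ X) x + s * (q.2 : WeakDual ℝ X) (m q.1)} := by
    simp only [Set.ofPred_forall]
    refine isClosed_iInter fun c => isClosed_iInter fun _ => ?_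
    -- Dividing by `s` leaves `t (m p)` with coefficient 1, so that `husc` applies as it stands.
    have hcont : Continuous fun q : Y × dualUnitBall X =>
        ((q.2 : WeakDual ℝ X) x - b - s * (q.2 : WeakDual ℝ X) c) / s :=
      (((heval x).sub continuous_const).sub (continuous_const.mul (heval c))).div_const s
    convert (husc.add hcont.upperSemicontinuous).isClosed_preimage 0 using 1
    ext q
    simp only [Set.mem_ofPred_eq, Set.mem_preimage, Set.mem_Ici]
    rw [← sub_nonneg, ← mul_nonneg_iff_of_pos_left hs (b := _ + _), mul_add, mul_div_cancel₀ _ hs.ne']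
    ring_nf
  convert isClosedMap_fst_of_compactSpace _ hclosed using 1
  ext p
  simp only [Set.mem_preimage, Set.mem_Ici, Set.mem_image, Set.mem_ofPred_eq, Prod.exists,
    exists_and_right, exists_eq_right]
  constructor
  · intro hb
    obtain ⟨t, ht, h⟩ := exists_separating_infDist (convex_dilationAt hC (m p) s) x
    refine ⟨⟨t, ht⟩, fun c hc => ?_⟩
    have := h _ ⟨c, hc, rfl⟩
    simp only [map_smul, map_sub, smul_eq_mul] at this
    linarith
  · rintro ⟨t, h⟩
    refine le_infDist_of_separating (dilationAt_nonempty (hm p) s) t.2 ?_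
    rintro _ ⟨c, hc, rfl⟩
    simp only [map_smul, map_sub, smul_eq_mul]
    linarith [h c hc]

/-- The distance is a maximum of `t x` over the bounded normal cone, and lower hemicontinuity keeps
functionals with `t x > a` available at nearby points. -/
theorem lowerSemicontinuous_infDist_convexTangentCone (hC : Convex ℝ C) (hm : ∀ p, m p ∈ C)
    (hlhc : LowerHemicontinuous fun p => dualUnitBall X ∩ convexNormalCone C (m p)) (x : X) :
    LowerSemicontinuous fun p => Metric.infDist x (convexTangentCone C (m p)) := by
  intro p a ha
  obtain ⟨t, ht, htx⟩ := exists_apply_eq_infDist_convexTangentCone hC (hm p) x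
  have hopen : IsOpen {t : WeakDual ℝ X | a < t x} :=
    isOpen_lt continuous_const (WeakDual.eval_continuous x)
  have := hlhc p _ ⟨hopen, ⟨t, ht, show a < t x by rwa [htx]⟩⟩
  filter_upwards [this] with q hq
  obtain ⟨u, hu, hux⟩ := hq.2
  exact lt_of_lt_of_le hux (apply_le_infDist_convexTangentCone (hm q) hu x)

/-- A Dini type theorem: the distances to the increasing sets `s (C - m p)` decrease to the
distance to their union, uniformly in `p`. -/
theorem eventually_infDist_dilationAt_lt [CompactSpace Y] (hC : Convex ℝ C) (hm : ∀ p, m p ∈ C)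
    (hlhc : LowerHemicontinuous fun p => dualUnitBall X ∩ convexNormalCone C (m p))
    (husc : UpperSemicontinuous
      (fun q : Y × dualUnitBall X => (q.2 : WeakDual ℝ X) (m q.1)))
    (x : X) {ε : ℝ} (hε : 0 < ε) :
    ∀ᶠ s : ℝ in atTop, ∀ p, Metric.infDist x (dilationAt C (m p) s) <
      Metric.infDist x (convexTangentCone C (m p)) + ε := by
  suffices h : ∀ᶠ s : ℝ in atTop, ∀ p ∈ (Set.univ : Set Y),
      Metric.infDist x (dilationAt C (m p) s) <
        Metric.infDist x (convexTangentCone C (m p)) + ε by simpa using h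
  refine isCompact_univ.induction_on (p := fun A => ∀ᶠ s : ℝ in atTop, ∀ p ∈ A,
    Metric.infDist x (dilationAt C (m p) s) < Metric.infDist x (convexTangentCone C (m p)) + ε)
    (by simp) (fun A B hAB h => h.mono fun s hs p hp => hs p (hAB hp))
    (fun A B hA hB => by
      filter_upwards [hA, hB] with s h1 h2 p hp using hp.elim (h1 p) (h2 p)) fun p _ => ?_
  obtain ⟨_, ⟨α, hα, c, hc, rfl⟩, hlt⟩ := (Metric.infDist_lt_iff
    (s := convexTangentCone C (m p)) (x := x) ⟨0, zero_mem_convexTangentCone (hm p)⟩).1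
    (lt_add_of_pos_right _ (half_pos hε))
  have hα' : Metric.infDist x (dilationAt C (m p) α) <
      Metric.infDist x (convexTangentCone C (m p)) + ε / 2 :=
    (Metric.infDist_le_dist_of_mem (Set.mem_image_of_mem _ hc)).trans_lt hlt
  have h1 := upperSemicontinuous_infDist_dilationAt hC hm husc hα x p _ hα'
  have h2 := lowerSemicontinuous_infDist_convexTangentCone hC hm hlhc x p
    (Metric.infDist x (convexTangentCone C (m p)) - ε / 2) (by linarith)
  -- Near `p`, the fixed dilation `α` loses at most `ε / 2` on each side; monotonicity extends this
  -- to all `s ≥ α`.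
  refine ⟨_, mem_nhdsWithin_of_mem_nhds (h1.and h2), ?_⟩
  filter_upwards [eventually_ge_atTop α] with s hs q hq
  have h3 : Metric.infDist x (dilationAt C (m q) s) ≤ Metric.infDist x (dilationAt C (m q) α) :=
    Metric.infDist_le_infDist_of_subset (dilationAt_mono hC (hm q) hα hs)
      (dilationAt_nonempty (hm q) α)
  have h4 := hq.1
  have h5 := hq.2
  linarith

theorem eventually_infDist_dilationAt_le_of_totallyBounded [CompactSpace Y] (hC : Convex ℝ C)
    (hm : ∀ p, m p ∈ C)
    (hlhc : LowerHemicontinuous fun p => dualUnitBall X ∩ convexNormalCone C (m p))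
    (husc : UpperSemicontinuous
      (fun q : Y × dualUnitBall X => (q.2 : WeakDual ℝ X) (m q.1)))
    {S : Set X} (hS : TotallyBounded S) {ε : ℝ} (hε : 0 < ε) :
    ∀ᶠ s : ℝ in atTop, ∀ p, ∀ x ∈ S, Metric.infDist x (dilationAt C (m p) s) ≤
      Metric.infDist x (convexTangentCone C (m p)) + ε := by
  obtain ⟨F, hF, hcover⟩ := Metric.totallyBounded_iff.1 hS (ε / 3) (by positivity)
  have := (hF.eventually_all (l := atTop)).2 fun y _ =>
    eventually_infDist_dilationAt_lt hC hm hlhc husc y (ε := ε / 3) (by positivity)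
  filter_upwards [this] with s hs p x hx
  obtain ⟨y, hy, hxy⟩ := Set.mem_iUnion₂.1 (hcover hx)
  rw [Metric.mem_ball] at hxy
  have h1 := hs y hy p
  have h2 := Metric.infDist_le_infDist_add_dist (s := dilationAt C (m p) s) (x := x) (y := y)
  have h3 := Metric.infDist_le_infDist_add_dist (s := convexTangentCone C (m p)) (x := y) (y := x)
  rw [dist_comm] at h3
  linarith

end Semicontinuity

/-! ### Lipschitz continuity of the infimum functional. -/

section InfimumFunctional

theorem abs_iInf_sub_iInf_le {ι : Type*} [Nonempty ι] {f g : ι → ℝ} (hf : ∀ i, 0 ≤ f i)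
    (hg : ∀ i, 0 ≤ g i) {d : ℝ} (h : ∀ i, |f i - g i| ≤ d) : |(⨅ i, f i) - ⨅ i, g i| ≤ d := by
  have key : ∀ {f g : ι → ℝ}, (∀ i, 0 ≤ f i) → (∀ i, |f i - g i| ≤ d) →
      (⨅ i, f i) - d ≤ ⨅ i, g i := fun {f g} hf h => le_ciInf fun i => by
    linarith [ciInf_le ⟨0, Set.forall_mem_range.2 hf⟩ i, (abs_le.1 (h i)).2]
  refine abs_le.2 ⟨?_, ?_⟩
  · linarith [key hg fun i => by rw [abs_sub_comm]; exact h i]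
  · linarith [key hf h]

theorem lipschitzWith_iInf_infDist {Θ X : Type*} [Nonempty Θ] [PseudoMetricSpace X]
    (K : Θ → Set X) :
    LipschitzWith 1 fun g : Θ →ᵤ X => ⨅ θ, Metric.infDist (UniformFun.toFun g θ) (K θ) := by
  intro g g'
  rw [ENNReal.coe_one, one_mul]
  rcases eq_or_ne (edist g g') ⊤ with htop | htop
  -- Maps at infinite uniform distance satisfy the bound trivially.
  · simp [htop]
  rw [edist_dist (α := ℝ), ← ENNReal.ofReal_toReal htop, Real.dist_eq]
  refine ENNReal.ofReal_le_ofReal (abs_iInf_sub_iInf_le (fun _ => Metric.infDist_nonneg)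
    (fun _ => Metric.infDist_nonneg) fun θ => ?_)
  have h1 := (Metric.lipschitz_infDist_pt (K θ)).dist_le_mul
    (UniformFun.toFun g θ) (UniformFun.toFun g' θ)
  rw [NNReal.coe_one, one_mul, Real.dist_eq] at h1
  refine h1.trans ?_
  rw [dist_edist]
  exact ENNReal.toReal_mono htop
    (le_iSup (fun θ => edist (UniformFun.toFun g θ) (UniformFun.toFun g' θ)) θ)

end InfimumFunctional

/-! ### Bounded Lipschitz expectations. -/

section Expectation

theorem boundedLipschitz_comp {E F : Type*} [PseudoEMetricSpace E] [PseudoEMetricSpace F]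
    {h : F → ℝ} (hh : h ∈ boundedLipschitz F) {φ : E → F} (hφ : LipschitzWith 1 φ) :
    h ∘ φ ∈ boundedLipschitz E :=
  ⟨by simpa using hh.1.comp hφ, fun x => hh.2 (φ x)⟩

/-- Two random variables that are close on a likely event have close bounded Lipschitz
expectations. -/
theorem abs_integral_boundedLipschitz_sub_le {Ω : Type*} [MeasurableSpace Ω] (ν : Measure Ω)
    [IsProbabilityMeasure ν] {U V : Ω → ℝ} (hU : Measurable U) (hV : Measurable V) {h : ℝ → ℝ}
    (hh : h ∈ boundedLipschitz ℝ) {A : Set Ω} (hA : MeasurableSet A) {ε : ℝ} (hε : 0 ≤ ε)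
    (hUV : ∀ ω ∈ A, |U ω - V ω| ≤ ε) :
    |∫ ω, h (U ω) ∂ν - ∫ ω, h (V ω) ∂ν| ≤ ε + 2 * ν.real Aᶜ := by
  have hint : ∀ {W : Ω → ℝ}, Measurable W → Integrable (fun ω => h (W ω)) ν := fun {W} hW =>
    Integrable.of_bound (hh.1.continuous.measurable.comp hW).aestronglyMeasurable 1
      (ae_of_all _ fun ω => hh.2 (W ω))
  rw [← integral_sub (hint hU) (hint hV)]
  have hint2 : Integrable (fun ω => ε + Aᶜ.indicator (fun _ => (2 : ℝ)) ω) ν :=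
    (integrable_const ε).add ((integrable_const (2 : ℝ)).indicator hA.compl)
  rw [← Real.norm_eq_abs]
  refine (norm_integral_le_of_norm_le hint2 (ae_of_all _ fun ω => ?_)).trans_eq ?_
  · rw [Real.norm_eq_abs]
    by_cases hω : ω ∈ A
    · have h1 := hh.1.dist_le_mul (U ω) (V ω)
      rw [NNReal.coe_one, one_mul, Real.dist_eq, Real.dist_eq] at h1
      simpa [hω] using h1.trans (hUV ω hω)
    · have h1 := abs_le.1 (hh.2 (U ω))
      have h2 := abs_le.1 (hh.2 (V ω))
      simp only [Set.indicator_of_mem (Set.mem_compl hω)]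
      exact abs_le.2 ⟨by linarith, by linarith⟩
  · rw [integral_add (integrable_const ε) ((integrable_const (2 : ℝ)).indicator hA.compl),
      integral_indicator_const _ hA.compl]
    simp [mul_comm]

theorem isClosed_setOf_forall_mem {Θ X : Type*} [UniformSpace X] {S : Set X} (hS : IsClosed S) :
    IsClosed {g : Θ →ᵤ X | ∀ θ, UniformFun.toFun g θ ∈ S} := by
  simp only [Set.ofPred_forall]
  exact isClosed_iInter fun θ =>
    hS.preimage (UniformFun.uniformContinuous_eval X θ).continuous

end Expectation

theorem proposition2
    {X : Type*} [NormedAddCommGroup X] [NormedSpace ℝ X] [CompleteSpace X]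
    {𝔓 Θ : Type*} [Nonempty Θ]
    -- the probability spaces of the estimators and of the limits
    {Ω : ℕ → 𝔓 → Type*} [∀ n P, MeasurableSpace (Ω n P)]
    (μ : ∀ n P, Measure (Ω n P)) [∀ n P, IsProbabilityMeasure (μ n P)]
    {Ω' : 𝔓 → Type*} [∀ P, MeasurableSpace (Ω' P)]
    (ν : ∀ P, Measure (Ω' P)) [∀ P, IsProbabilityMeasure (ν P)]
    (C : Set X) (hC : Convex ℝ C)
    (m : 𝔓 → Θ → X) (hm : ∀ P θ, m P θ ∈ C)
    (mn : ∀ n P, Ω n P → Θ → X)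
    (r : ℕ → ℝ) (hr : Tendsto r atTop atTop)
    (G : ∀ P, Ω' P → Θ → X)
    (hG : UniformWeakConvergence (E := Θ →ᵤ X)
      μ (fun n P ω => UniformFun.ofFun fun θ => r n • (mn n P ω θ - m P θ))
      ν (fun P ω => UniformFun.ofFun (G P ω)))
    (hGtight : UniformlyPretight ν G)
    -- a topology on pairs, not assumed to be a product topology
    [TopologicalSpace (𝔓 × Θ)] [CompactSpace (𝔓 × Θ)]
    (hlhc : LowerHemicontinuous
      (fun p : 𝔓 × Θ => dualUnitBall X ∩ convexNormalCone C (m p.1 p.2)))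
    (husc : UpperSemicontinuous
      (fun q : (𝔓 × Θ) × dualUnitBall X => (q.2 : WeakDual ℝ X) (m q.1.1 q.1.2))) :
    UniformWeakConvergence (E := ℝ)
      μ (fun n P ω => r n * ⨅ θ, Metric.infDist (mn n P ω θ) C)
      ν (fun P ω => ⨅ θ, ⨆ t : ↥(dualUnitBall X ∩ convexNormalCone C (m P θ)),
        (t : WeakDual ℝ X) (G P ω θ)) ∧
    ∀ P ω,
      (⨅ θ, ⨆ t : ↥(dualUnitBall X ∩ convexNormalCone C (m P θ)),
        (t : WeakDual ℝ X) (G P ω θ)) =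
      ⨅ θ, Metric.infDist (G P ω θ) (convexTangentCone C (m P θ)) := by
  have hdual : ∀ P ω, (⨅ θ, ⨆ t : ↥(dualUnitBall X ∩ convexNormalCone C (m P θ)),
      (t : WeakDual ℝ X) (G P ω θ)) =
      ⨅ θ, Metric.infDist (G P ω θ) (convexTangentCone C (m P θ)) := fun P ω =>
    iInf_congr fun θ => iSup_normalCone_eq_infDist hC (hm P θ) _
  refine ⟨?_, hdual⟩
  simp only [hdual]
  obtain ⟨hGmeas, hGlim⟩ := hG
  let : MeasurableSpace (Θ →ᵤ X) := borel _
  have : BorelSpace (Θ →ᵤ X) := ⟨rfl⟩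
  have hmeas : ∀ (P : 𝔓) (K : Θ → Set X),
      Measurable fun ω => ⨅ θ, Metric.infDist (G P ω θ) (K θ) := fun P K =>
    (lipschitzWith_iInf_infDist K).continuous.measurable.comp (hGmeas P)
  refine ⟨fun P => hmeas P _, ?_⟩
  rw [ENNReal.tendsto_nhds_zero] at hGlim ⊢
  intro δ hδ
  -- The total `3 * η` is `η` from the Dini error plus `2 * η` from the exceptional event.
  obtain ⟨η, hη, hηδ⟩ : ∃ η : ℝ, 0 < η ∧ ENNReal.ofReal (3 * η) ≤ δ / 2 := by
    obtain ⟨a, ha, haδ⟩ := ENNReal.lt_iff_exists_nnreal_btwn.1 (ENNReal.half_pos hδ.ne')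
    refine ⟨a / 3, by have : (0 : ℝ) < a := by exact_mod_cast ha
                      positivity, ?_⟩
    rw [mul_div_cancel₀ _ three_ne_zero, ENNReal.ofReal_coe_nnreal]
    exact haδ.le
  obtain ⟨S, hS, -, hSν⟩ := hGtight η hη
  have hunif := hr.eventually (eventually_infDist_dilationAt_le_of_totallyBounded hC
    (fun p : 𝔓 × Θ => hm p.1 p.2) hlhc husc hS.closure hη)
  filter_upwards [hunif, hr.eventually_gt_atTop 0, hGlim (δ / 2) (ENNReal.half_pos hδ.ne')]
    with n hn hrn hGn
  refine iSup_le fun P => iSup₂_le fun h hh => ?_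
  -- The closure remains totally bounded and makes the event closed in the uniform distance, hence
  -- measurable even for uncountable `Θ`.
  set A : Set (Ω' P) := {ω | ∀ θ, G P ω θ ∈ closure S}
  have hA : MeasurableSet A :=
    hGmeas P (isClosed_setOf_forall_mem (Θ := Θ) isClosed_closure).measurableSet
  have hAν : (ν P).real Aᶜ ≤ η := by
    have h1 : 1 - ENNReal.ofReal η ≤ ν P A := (hSν.le.trans (iInf_le _ P)).trans
      (measure_mono fun ω hω θ => subset_closure (hω θ))
    refine ENNReal.toReal_le_of_le_ofReal hη.le ?_
    rw [prob_compl_eq_one_sub hA]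
    exact tsub_le_iff_tsub_le.1 h1
  set φ : (Θ →ᵤ X) → ℝ := fun g =>
    ⨅ θ, Metric.infDist (UniformFun.toFun g θ) (dilationAt C (m P θ) (r n)) with hφ
  have hφn : (fun ω => h (r n * ⨅ θ, Metric.infDist (mn n P ω θ) C)) =
      fun ω => (h ∘ φ) (UniformFun.ofFun fun θ => r n • (mn n P ω θ - m P θ)) := by
    funext ω
    simp only [Function.comp_apply, hφ, UniformFun.toFun_ofFun]
    rw [Real.mul_iInf_of_nonneg hrn.le]
    exact congrArg h (iInf_congr fun θ => mul_infDist_eq_infDist_dilationAt (hm P θ) hrn.le _)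
  have hfirst : ENNReal.ofReal |outerExpectation (μ n P)
      (fun ω => h (r n * ⨅ θ, Metric.infDist (mn n P ω θ) C)) -
      ∫ ω, (h ∘ φ) (UniformFun.ofFun (G P ω)) ∂(ν P)| ≤ δ / 2 := by
    rw [hφn]
    exact (le_iSup₂_of_le (h ∘ φ) (boundedLipschitz_comp hh (lipschitzWith_iInf_infDist _))
      le_rfl).trans ((le_iSup _ P).trans hGn)
  have hsecond : |∫ ω, (h ∘ φ) (UniformFun.ofFun (G P ω)) ∂(ν P) -
      ∫ ω, h (⨅ θ, Metric.infDist (G P ω θ) (convexTangentCone C (m P θ))) ∂(ν P)| ≤ 3 * η := by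
    refine (abs_integral_boundedLipschitz_sub_le (ν P) (hmeas P _) (hmeas P _) hh hA hη.le
      fun ω hω => ?_).trans (by linarith)
    refine abs_iInf_sub_iInf_le (fun _ => Metric.infDist_nonneg)
      (fun _ => Metric.infDist_nonneg) fun θ => abs_le.2 ⟨?_, ?_⟩
    · linarith [infDist_convexTangentCone_le_infDist_dilationAt (hm P θ) hrn (G P ω θ)]
    · linarith [hn (P, θ) _ (hω θ)]
  refine (ENNReal.ofReal_le_ofReal (abs_sub_le _
    (∫ ω, (h ∘ φ) (UniformFun.ofFun (G P ω)) ∂(ν P)) _)).trans ?_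
  rw [ENNReal.ofReal_add (abs_nonneg _) (abs_nonneg _), ← ENNReal.add_halves δ]
  exact add_le_add hfirst ((ENNReal.ofReal_le_ofReal hsecond).trans hηδ)
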